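/- Let $D$ be a ring with one, let $M,L,N$ be (left) $D$-modules, and let $\eta^M_L\in\operatorname{Ext}^1_D(M,L)$ and $\eta^L_N\in\operatorname{Ext}^1_D(L,N)$. A $(\eta^M_L,\eta^L_N)$-extension module is a $D$-module $E$ with a chain of submodules $E\ge E_1\ge E_2\ge 0$ and identifications $E/E_1\cong M$, $E_1/E_2\cong L$, $E_2\cong N$, such that the induced short exact sequences $0\to L\to E/E_2\to M\to 0$ and $0\to N\to E_1\to L\to 0$ have the classes $\eta^M_L$ and $\eta^L_N$ respectively. Two such modules $E,E'$ are equivalent if there is an isomorphism $\alpha:E\to E'$ of $D$-modules with $\alpha(E_i)=E'_i$ for $i=1,2$ which induces the identity on the subfactors $M,L,N$. Let $\operatorname{ExtMod}(\eta^M_L,\eta^L_N)$ be the set of equivalence classes; the pair $(\eta^M_L,\eta^L_N)$ is called rigid if $|\operatorname{ExtMod}(\eta^M_L,\eta^L_N)|=1$. With $\circ$ the Yoneda product (written in the order $\operatorname{Ext}^a(X,Y)\times\operatorname{Ext}^b(Y,Z)\to\operatorname{Ext}^{a+b}(X,Z)$), put $$\operatorname{Ext}^1(\eta^M_L,\eta^L_N):=\operatorname{Ext}^1_D(M,N)\big/\big(\operatorname{Hom}_D(M,L)\circ\eta^L_N+\eta^M_L\circ\operatorname{Hom}_D(L,N)\big).$$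 Then $(\eta^M_L,\eta^L_N)$ is rigid if and only if a $(\eta^M_L,\eta^L_N)$-extension module exists and $\operatorname{Ext}^1(\eta^M_L,\eta^L_N)=0$. -/

import Mathlib

open CategoryTheory CategoryTheory.Abelian

universe u v

noncomputable section

/-- A 2-extension module over `D`: a (left) `D`-module `E` together with a chain of submodules
`E ≥ E₁ ≥ E₂ ≥ 0`. -/
structure TwoExtensionModule (D : Type u) [Ring D] where
  /-- the ambient module -/
  E : ModuleCat.{v} D
  /-- the first step of the chain -/
  E₁ : Submodule D E
  /-- the second step of the chain -/
  E₂ : Submodule D E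
  le : E₂ ≤ E₁

/-- A 2-extension module whose subfactors `E/E₁`, `E₁/E₂`, `E₂` are identified with the given
modules `M`, `L`, `N`. -/
structure TwoExtensionModuleOf {D : Type u} [Ring D] (M L N : ModuleCat.{v} D) extends
    TwoExtensionModule.{u, v} D where
  /-- the identification `E/E₁ ≅ M` -/
  top : (E ⧸ E₁) ≃ₗ[D] M
  /-- the identification `E₁/E₂ ≅ L` -/
  mid : (E₁ ⧸ E₂.submoduleOf E₁) ≃ₗ[D] L
  /-- the identification `E₂ ≅ N` -/
  bot : E₂ ≃ₗ[D] N

namespace TwoExtensionModuleOf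

variable {D : Type u} [Ring D] {M L N : ModuleCat.{v} D}

/-- The natural injection `L ≅ E₁/E₂ → E/E₂`. -/
def ι₀ (X : TwoExtensionModuleOf M L N) : L →ₗ[D] (X.E ⧸ X.E₂) :=
  (Submodule.mapQ (X.E₂.submoduleOf X.E₁) X.E₂ X.E₁.subtype le_rfl) ∘ₗ X.mid.symm.toLinearMap

/-- The natural surjection `E/E₂ → E/E₁ ≅ M`. -/
def π₀ (X : TwoExtensionModuleOf M L N) : (X.E ⧸ X.E₂) →ₗ[D] M :=
  X.top.toLinearMap ∘ₗ Submodule.factor X.le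

/-- The natural injection `N ≅ E₂ → E₁`. -/
def ι₁ (X : TwoExtensionModuleOf M L N) : N →ₗ[D] X.E₁ :=
  Submodule.inclusion X.le ∘ₗ X.bot.symm.toLinearMap

/-- The natural surjection `E₁ → E₁/E₂ ≅ L`. -/
def π₁ (X : TwoExtensionModuleOf M L N) : X.E₁ →ₗ[D] L :=
  X.mid.toLinearMap ∘ₗ (X.E₂.submoduleOf X.E₁).mkQ

theorem ι₀_injective (X : TwoExtensionModuleOf M L N) : Function.Injective X.ι₀ := by
  rw [injective_iff_map_eq_zero]
  intro l hl
  obtain ⟨q, rfl⟩ := X.mid.surjective l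
  obtain ⟨x, rfl⟩ := Submodule.Quotient.mk_surjective _ q
  have h2 : (Submodule.Quotient.mk (x : X.E) : X.E ⧸ X.E₂) = 0 := by
    rw [← hl]
    simp only [ι₀, LinearMap.comp_apply, LinearEquiv.coe_coe, LinearEquiv.symm_apply_apply]
    rfl
  rw [Submodule.Quotient.mk_eq_zero] at h2
  rw [(Submodule.Quotient.mk_eq_zero (X.E₂.submoduleOf X.E₁) (x := x)).2 h2, map_zero]

theorem π₀_surjective (X : TwoExtensionModuleOf M L N) : Function.Surjective X.π₀ :=
  X.top.surjective.comp (Submodule.factor_surjective X.le)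

theorem exact₀ (X : TwoExtensionModuleOf M L N) : Function.Exact X.ι₀ X.π₀ := by
  intro y
  obtain ⟨e, rfl⟩ := Submodule.mkQ_surjective _ y
  have h1 : X.π₀ (X.E₂.mkQ e) = 0 ↔ e ∈ X.E₁ := by
    simp [π₀]
  rw [h1]
  constructor
  · intro he
    exact ⟨X.mid (Submodule.Quotient.mk ⟨e, he⟩), by
      simp only [ι₀, LinearMap.comp_apply, LinearEquiv.coe_coe, LinearEquiv.symm_apply_apply]
      rfl⟩
  · rintro ⟨l, hl⟩
    obtain ⟨q, rfl⟩ := X.mid.surjective l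
    obtain ⟨x, rfl⟩ := Submodule.mkQ_surjective _ q
    have h2 : (x : X.E) - e ∈ X.E₂ := by
      rw [← Submodule.Quotient.eq]
      refine Eq.trans ?_ hl
      simp only [ι₀, LinearMap.comp_apply, LinearEquiv.coe_coe, LinearEquiv.symm_apply_apply]
      rfl
    have h3 := X.E₁.sub_mem x.2 (X.le h2)
    simpa using h3

theorem ι₁_injective (X : TwoExtensionModuleOf M L N) : Function.Injective X.ι₁ :=
  (Submodule.inclusion_injective X.le).comp X.bot.symm.injective

theorem π₁_surjective (X : TwoExtensionModuleOf M L N) : Function.Surjective X.π₁ :=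
  X.mid.surjective.comp (Submodule.mkQ_surjective _)

theorem exact₁ (X : TwoExtensionModuleOf M L N) : Function.Exact X.ι₁ X.π₁ := by
  intro x
  have h1 : X.π₁ x = 0 ↔ (x : X.E) ∈ X.E₂ := by
    simp only [π₁, LinearMap.comp_apply, LinearEquiv.coe_coe, LinearEquiv.map_eq_zero_iff,
      Submodule.mkQ_apply, Submodule.Quotient.mk_eq_zero]
    rfl
  rw [h1]
  constructor
  · intro hx
    exact ⟨X.bot ⟨x, hx⟩, by ext; simp [ι₁]⟩
  · rintro ⟨n, rfl⟩
    exact (X.bot.symm n).2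

/-- The short exact sequence `0 ← M ← G₀ ← L ← 0` with `G₀ = E/E₂`. -/
def G₀ (X : TwoExtensionModuleOf M L N) : ShortComplex (ModuleCat.{v} D) where
  X₁ := L
  X₂ := ModuleCat.of D (X.E ⧸ X.E₂)
  X₃ := M
  f := ModuleCat.ofHom X.ι₀
  g := ModuleCat.ofHom X.π₀
  zero := by
    ext l
    exact X.exact₀.apply_apply_eq_zero l

/-- The short exact sequence `0 ← L ← G₁ ← N ← 0` with `G₁ = E₁`. -/
def G₁ (X : TwoExtensionModuleOf M L N) : ShortComplex (ModuleCat.{v} D) where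
  X₁ := N
  X₂ := ModuleCat.of D X.E₁
  X₃ := L
  f := ModuleCat.ofHom X.ι₁
  g := ModuleCat.ofHom X.π₁
  zero := by
    ext n
    exact X.exact₁.apply_apply_eq_zero n

theorem G₀_shortExact (X : TwoExtensionModuleOf M L N) : X.G₀.ShortExact where
  exact := (ShortComplex.ShortExact.moduleCat_exact_iff_function_exact X.G₀).2 X.exact₀
  mono_f := (ModuleCat.mono_iff_injective _).2 X.ι₀_injective
  epi_g := (ModuleCat.epi_iff_surjective _).2 X.π₀_surjective

theorem G₁_shortExact (X : TwoExtensionModuleOf M L N) : X.G₁.ShortExact where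
  exact := (ShortComplex.ShortExact.moduleCat_exact_iff_function_exact X.G₁).2 X.exact₁
  mono_f := (ModuleCat.mono_iff_injective _).2 X.ι₁_injective
  epi_g := (ModuleCat.epi_iff_surjective _).2 X.π₁_surjective

/-- The 1-cocycle in `Ext¹(M, L)` of the short exact sequence `G₀`. -/
def class₀ [Small.{v} D] (X : TwoExtensionModuleOf M L N) : Ext M L 1 :=
  X.G₀_shortExact.extClass

/-- The 1-cocycle in `Ext¹(L, N)` of the short exact sequence `G₁`. -/
def class₁ [Small.{v} D] (X : TwoExtensionModuleOf M L N) : Ext L N 1 :=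
  X.G₁_shortExact.extClass

/-- Equivalence of 2-extension modules: an isomorphism `α : E ≅ E'` which maps `Eᵢ` onto `E'ᵢ`
and induces the identity on the subfactors `M`, `L` and `N`. -/
def Equivalent (X Y : TwoExtensionModuleOf M L N) : Prop :=
  ∃ α : X.E ≃ₗ[D] Y.E,
    X.E₁.map α.toLinearMap = Y.E₁ ∧ X.E₂.map α.toLinearMap = Y.E₂ ∧
    (∀ x : X.E, Y.top (Submodule.Quotient.mk (α x)) = X.top (Submodule.Quotient.mk x)) ∧
    (∀ (x : X.E₁) (y : Y.E₁), (y : Y.E) = α x →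
      Y.mid (Submodule.Quotient.mk y) = X.mid (Submodule.Quotient.mk x)) ∧
    (∀ (x : X.E₂) (y : Y.E₂), (y : Y.E) = α x → Y.bot y = X.bot x)

theorem equivalent_equivalence :
    Equivalence (Equivalent : TwoExtensionModuleOf M L N → TwoExtensionModuleOf M L N → Prop) where
  refl X := by
    refine ⟨LinearEquiv.refl D X.E, by simp, by simp, fun _ => rfl, ?_, ?_⟩
    · intro x y h
      rw [show y = x from Subtype.ext h]
    · intro x y h
      rw [show y = x from Subtype.ext h]
  symm := by
    rintro X Y ⟨α, h1, h2, ht, hm, hb⟩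
    refine ⟨α.symm, ?_, ?_, ?_, ?_, ?_⟩
    · rw [← h1]
      ext x
      simp
    · rw [← h2]
      ext x
      simp
    · intro y
      rw [← ht, α.apply_symm_apply]
    · intro y x h
      exact (hm x y (by rw [h, α.apply_symm_apply])).symm
    · intro y x h
      exact (hb x y (by rw [h, α.apply_symm_apply])).symm
  trans := by
    rintro X Y Z ⟨α, h1, h2, ht, hm, hb⟩ ⟨β, k1, k2, kt, km, kb⟩
    refine ⟨α.trans β, ?_, ?_, ?_, ?_, ?_⟩
    · rw [← k1, ← h1, ← Submodule.map_comp]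
      rfl
    · rw [← k2, ← h2, ← Submodule.map_comp]
      rfl
    · intro x
      rw [← ht, ← kt]
      rfl
    · intro x z h
      have hy : α x ∈ Y.E₁ := h1 ▸ Submodule.mem_map_of_mem x.2
      rw [← hm x ⟨α x, hy⟩ rfl]
      exact km ⟨α x, hy⟩ z h
    · intro x z h
      have hy : α x ∈ Y.E₂ := h2 ▸ Submodule.mem_map_of_mem x.2
      rw [← hb x ⟨α x, hy⟩ rfl]
      exact kb ⟨α x, hy⟩ z h

end TwoExtensionModuleOf

section

variable {D : Type u} [Ring D] [Small.{v} D] {M L N : ModuleCat.{v} D}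

/-- The `(ηML, ηLN)`-extension modules: those 2-extension modules with subfactors `M`, `L`, `N`
for which `ηML` corresponds to `G₀ = E/E₂` and `ηLN` corresponds to `G₁ = E₁`. -/
def AdmissibleExtModule (ηML : Ext M L 1) (ηLN : Ext L N 1) : Type (max u (v + 1)) :=
  {X : TwoExtensionModuleOf.{u, v} M L N // X.class₀ = ηML ∧ X.class₁ = ηLN}

/-- Equivalence of `(ηML, ηLN)`-extension modules. -/
def extModSetoid (ηML : Ext M L 1) (ηLN : Ext L N 1) : Setoid (AdmissibleExtModule ηML ηLN) :=
  Setoid.comap Subtype.val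
    ⟨TwoExtensionModuleOf.Equivalent, TwoExtensionModuleOf.equivalent_equivalence⟩

/-- The set `ExtMod(ηML, ηLN)` of `(ηML, ηLN)`-extension modules up to equivalence. -/
def ExtMod (ηML : Ext M L 1) (ηLN : Ext L N 1) : Type (max u (v + 1)) :=
  Quotient (extModSetoid ηML ηLN)

/-- The pair `(ηML, ηLN)` is rigid if `ExtMod(ηML, ηLN)` has exactly one element. -/
def IsRigidPair (ηML : Ext M L 1) (ηLN : Ext L N 1) : Prop :=
  Nat.card (ExtMod ηML ηLN) = 1

/-- The subgroup `Hom(M, L) ∘ ηLN + ηML ∘ Hom(L, N)` of `Ext¹(M, N)`; `Ext⁰` is `Hom` and the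
products are Yoneda products. -/
def cocycleIndeterminacy (ηML : Ext M L 1) (ηLN : Ext L N 1) : AddSubgroup (Ext M N 1) :=
  (ηLN.postcomp M (zero_add 1)).range ⊔ (ηML.precomp N (add_zero 1)).range

/-- The first extension group of 1-cocycles,
`Ext¹(ηML, ηLN) = Ext¹(M, N) / (Hom(M, L) ∘ ηLN + ηML ∘ Hom(L, N))`. -/
abbrev ExtOneCocycles (ηML : Ext M L 1) (ηLN : Ext L N 1) : Type v :=
  Ext M N 1 ⧸ cocycleIndeterminacy ηML ηLN

end

end

/-! An extension module is an extension `E₁` of `L` by `N` of class `ηLN`, together with a class `ε`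
in `Ext¹(M, E₁)` (`fullClass`) whose image in `Ext¹(M, L)` is `ηML`. An equivalence is a map `a : E₁
→ E₁'` inducing the identity on `N` and `L` and carrying `ε` to `ε'` (`Equivalent.exists_hom`,
`Equivalent.of_hom`). By the long exact sequence of `Ext(M, -)`, two lifts of `ηML` differ by the
image of some `x` in `Ext¹(M, N)`, which is determined up to `Hom(M, L) ∘ ηLN`. Two choices of `a`
differ by a map `E₁ → L → N → E₁'` given by some `h : L → N`, and this moves `x` by `ηML ∘ h`. So
the quotient `Ext¹(ηML, ηLN)` is the exact obstruction to equivalence, and every `x` occurs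
(`exists_fullClass_eq_add`). -/

namespace CategoryTheory.ShortComplex.ShortExact

-- Extension classes: morphisms, pushouts and realization.

universe w' u' v'

variable {C : Type u'} [Category.{v'} C] [Abelian C] [HasExt.{w'} C]

/-- The converse of `extClass_naturality`: a pair of morphisms between the outer terms which is
compatible with the extension classes extends to a morphism of short exact sequences. -/
theorem exists_hom_of_extClass_comp_eq {S₁ S₂ : ShortComplex C} (h₁ : S₁.ShortExact)
    (h₂ : S₂.ShortExact) (a : S₁.X₁ ⟶ S₂.X₁) (c : S₁.X₃ ⟶ S₂.X₃)
    (h : h₁.extClass.comp (Ext.mk₀ a) (add_zero 1) =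
      (Ext.mk₀ c).comp h₂.extClass (zero_add 1)) :
    ∃ φ : S₁ ⟶ S₂, φ.τ₁ = a ∧ φ.τ₃ = c := by
  have := h₁.epi_g
  -- Vanishing of this class is the obstruction to extending `a ≫ S₂.f` along `S₁.f`.
  have hobs : h₁.extClass.comp (Ext.mk₀ (a ≫ S₂.f)) (add_zero 1) = 0 := by
    rw [← Ext.mk₀_comp_mk₀, ← Ext.comp_assoc _ _ _ (add_zero 1) (zero_add 0) (by lia), h,
      Ext.comp_assoc _ _ _ (zero_add 1) (add_zero 1) (by lia), extClass_comp, Ext.comp_zero]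
  obtain ⟨x, hx⟩ := Ext.contravariant_sequence_exact₁ h₁ _ _ (add_zero 1) hobs
  obtain ⟨b, rfl⟩ := (Ext.mk₀_bijective _ _).2 x
  rw [Ext.mk₀_comp_mk₀] at hx
  replace hx : S₁.f ≫ b = a ≫ S₂.f := (Ext.mk₀_bijective _ _).1 hx
  let d : S₁.X₃ ⟶ S₂.X₃ := h₁.exact.desc (b ≫ S₂.g) (by
    rw [← Category.assoc, hx, Category.assoc, S₂.zero, Limits.comp_zero])
  have hd : S₁.g ≫ d = b ≫ S₂.g := h₁.exact.g_desc _ _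
  let ψ : S₁ ⟶ S₂ := { τ₁ := a, τ₂ := b, τ₃ := d, comm₁₂ := hx.symm, comm₂₃ := hd.symm }
  have hψ := extClass_naturality h₁ h₂ ψ
  -- The extension `b` induces some `d`, possibly different from `c`. Both pull the class of `S₂`
  -- back to the same class, so `c - d` lifts to `S₂.X₂`, and the lift corrects `b`.
  have hlift : (Ext.mk₀ (c - d)).comp h₂.extClass (zero_add 1) = 0 := by
    rw [sub_eq_add_neg, Ext.mk₀_add, Ext.mk₀_neg, Ext.add_comp, Ext.neg_comp, ← h, hψ]
    exact add_neg_cancel _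
  obtain ⟨y, hy⟩ := Ext.covariant_sequence_exact₃ _ h₂ _ (zero_add 1) hlift
  obtain ⟨s, rfl⟩ := (Ext.mk₀_bijective _ _).2 y
  rw [Ext.mk₀_comp_mk₀] at hy
  replace hy : s ≫ S₂.g = c - d := (Ext.mk₀_bijective _ _).1 hy
  exact ⟨{ τ₁ := a
           τ₂ := b + S₁.g ≫ s
           τ₃ := c
           comm₁₂ := by simp [hx]
           comm₂₃ := by simp [hy, hd] }, rfl, rfl⟩

open Limits in
/-- The pushout of a short exact sequence along a morphism out of its first term. -/
theorem exists_extClass_eq_extClass_comp {T : ShortComplex C} (hT : T.ShortExact) {A : C}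
    (k : T.X₁ ⟶ A) :
    ∃ (E : C) (f : A ⟶ E) (g : E ⟶ T.X₃) (zero : f ≫ g = 0)
      (hS : (ShortComplex.mk f g zero).ShortExact),
      hS.extClass = hT.extClass.comp (Ext.mk₀ k) (add_zero 1) := by
  have := hT.mono_f
  have := hT.epi_g
  let g : pushout T.f k ⟶ T.X₃ := pushout.desc T.g 0 (by simp)
  have hg : pushout.inl T.f k ≫ g = T.g := pushout.inl_desc _ _ _
  have hg' : pushout.inr T.f k ≫ g = 0 := pushout.inr_desc _ _ _
  let φ : T ⟶ ShortComplex.mk (pushout.inr T.f k) g hg' :=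
    { τ₁ := k
      τ₂ := pushout.inl T.f k
      τ₃ := 𝟙 T.X₃
      comm₁₂ := pushout.condition.symm
      comm₂₃ := hg.trans (Category.comp_id _).symm }
  have hepi : Epi g := epi_of_epi_fac hg
  have hcok : IsColimit (CokernelCofork.ofπ g hg') :=
    CokernelCofork.IsColimit.ofπ' _ _ fun {Z} t ht => by
      refine ⟨hT.exact.desc (pushout.inl T.f k ≫ t) (by
        rw [pushout.condition_assoc, ht, comp_zero]), pushout.hom_ext ?_ ?_⟩
      · rw [← Category.assoc, hg]
        exact hT.exact.g_desc _ _
      · rw [← Category.assoc, hg', zero_comp, ht]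
  have hS : (ShortComplex.mk (pushout.inr T.f k) g hg').ShortExact :=
    { exact := ShortComplex.exact_of_g_is_cokernel _ hcok
      mono_f := inferInstanceAs (Mono (pushout.inr T.f k))
      epi_g := hepi }
  refine ⟨_, _, _, hg', hS, ?_⟩
  rw [extClass_naturality hT hS φ]
  exact (Ext.mk₀_id_comp _).symm

open Limits in
/-- In the presence of enough projectives every class of `Ext¹` comes from an extension. -/
theorem exists_extClass_eq [EnoughProjectives C] {M A : C} (e : Ext.{w'} M A 1) :
    ∃ (E : C) (f : A ⟶ E) (g : E ⟶ M) (zero : f ≫ g = 0)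
      (hS : (ShortComplex.mk f g zero).ShortExact), hS.extClass = e := by
  let T : ShortComplex C := .mk (kernel.ι (Projective.π M)) (Projective.π M) (kernel.condition _)
  have hT : T.ShortExact :=
    { exact := ShortComplex.exact_of_f_is_kernel _ (kernelIsKernel _)
      mono_f := inferInstanceAs (Mono (kernel.ι _))
      epi_g := inferInstanceAs (Epi (Projective.π M)) }
  have : Projective T.X₂ := inferInstanceAs (Projective (Projective.over M))
  -- Since `Ext¹` out of a projective vanishes, `e` is the pushforward of the syzygy sequence of `M`
  -- along some `k`.
  obtain ⟨x, hx⟩ := Ext.contravariant_sequence_exact₃ hT A e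
    (Ext.eq_zero_of_projective _) (add_zero 1)
  obtain ⟨k, rfl⟩ := (Ext.mk₀_bijective _ _).2 x
  rw [← hx]
  exact exists_extClass_eq_extClass_comp hT k

end CategoryTheory.ShortComplex.ShortExact

/-! ### Extension modules as classes in `Ext¹(M, E₁)`. -/

namespace TwoExtensionModuleOf

variable {D : Type u} [Ring D] {M L N : ModuleCat.{v} D}

/-- The short exact sequence `0 ← M ← E ← E₁ ← 0`. -/
def G (X : TwoExtensionModuleOf M L N) : ShortComplex (ModuleCat.{v} D) where
  X₁ := ModuleCat.of D X.E₁
  X₂ := X.E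
  X₃ := M
  f := ModuleCat.ofHom X.E₁.subtype
  g := ModuleCat.ofHom (X.top.toLinearMap ∘ₗ X.E₁.mkQ)
  zero := by
    ext x
    simp

theorem G_shortExact (X : TwoExtensionModuleOf M L N) : X.G.ShortExact where
  exact := (ShortComplex.ShortExact.moduleCat_exact_iff_function_exact X.G).2 <| by
    intro (x : X.E)
    change X.top (X.E₁.mkQ x) = 0 ↔ x ∈ Set.range X.E₁.subtype
    simp
  mono_f := (ModuleCat.mono_iff_injective _).2 X.E₁.subtype_injective
  epi_g := (ModuleCat.epi_iff_surjective _).2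
    (X.top.surjective.comp X.E₁.mkQ_surjective)

/-- The projection of `0 ← M ← E ← E₁ ← 0` onto `0 ← M ← E/E₂ ← L ← 0`. -/
def projG₀ (X : TwoExtensionModuleOf M L N) : X.G ⟶ X.G₀ where
  τ₁ := ModuleCat.ofHom X.π₁
  τ₂ := ModuleCat.ofHom X.E₂.mkQ
  τ₃ := 𝟙 M
  comm₁₂ := by
    ext (x : X.E₁)
    change X.ι₀ (X.π₁ x) = X.E₂.mkQ x
    simp only [ι₀, π₁, LinearMap.comp_apply, LinearEquiv.coe_coe, LinearEquiv.symm_apply_apply]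
    rfl
  comm₂₃ := by
    ext x
    rfl

section ExtClass

variable [Small.{v} D]

/-- The class in `Ext¹(M, E₁)` of the short exact sequence `0 ← M ← E ← E₁ ← 0`. -/
noncomputable def fullClass (X : TwoExtensionModuleOf M L N) : Ext M (ModuleCat.of D X.E₁) 1 :=
  X.G_shortExact.extClass

theorem fullClass_comp_π₁ (X : TwoExtensionModuleOf M L N) :
    X.fullClass.comp (Ext.mk₀ (ModuleCat.ofHom X.π₁)) (add_zero 1) = X.class₀ :=
  (ShortComplex.ShortExact.extClass_naturality X.G_shortExact X.G₀_shortExact X.projG₀).trans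
    (Ext.mk₀_id_comp _)

/-- An equivalence of 2-extension modules restricts to an equivalence of the extensions `E₁` which
carries the class of `E` in `Ext¹(M, E₁)` to that of `E'`. -/
theorem Equivalent.exists_hom {X Y : TwoExtensionModuleOf M L N} (h : X.Equivalent Y) :
    ∃ a : ModuleCat.of D X.E₁ ⟶ ModuleCat.of D Y.E₁,
      ModuleCat.ofHom X.ι₁ ≫ a = ModuleCat.ofHom Y.ι₁ ∧
      a ≫ ModuleCat.ofHom Y.π₁ = ModuleCat.ofHom X.π₁ ∧
      X.fullClass.comp (Ext.mk₀ a) (add_zero 1) = Y.fullClass := by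
  obtain ⟨α, h1, h2, ht, hm, hb⟩ := h
  have hα : ∀ x ∈ X.E₁, α x ∈ Y.E₁ := fun x hx => h1 ▸ Submodule.mem_map_of_mem hx
  let a : X.E₁ →ₗ[D] Y.E₁ := α.toLinearMap.restrict hα
  refine ⟨ModuleCat.ofHom a, ?_, ?_, ?_⟩
  · ext n
    have hmem : α (X.bot.symm n) ∈ Y.E₂ := h2 ▸ Submodule.mem_map_of_mem (X.bot.symm n).2
    have := hb (X.bot.symm n) ⟨_, hmem⟩ rfl
    rw [LinearEquiv.apply_symm_apply, ← LinearEquiv.eq_symm_apply] at this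
    exact congrArg (fun y : Y.E₂ => (y : Y.E)) this
  · ext x
    exact hm x (a x) rfl
  · let φ : X.G ⟶ Y.G :=
      { τ₁ := ModuleCat.ofHom a
        τ₂ := ModuleCat.ofHom α.toLinearMap
        τ₃ := 𝟙 M
        comm₁₂ := by ext x; rfl
        comm₂₃ := by ext x; exact ht x }
    exact (ShortComplex.ShortExact.extClass_naturality X.G_shortExact Y.G_shortExact φ).trans
      (Ext.mk₀_id_comp _)

/-- Converse of `Equivalent.exists_hom`. Compatibility with the classes extends `a` to a map `E →
E'` over `M`; the five lemma, applied to `E₁` and then to `E`, makes both maps isomorphisms. -/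
theorem Equivalent.of_hom {X Y : TwoExtensionModuleOf M L N}
    (a : ModuleCat.of D X.E₁ ⟶ ModuleCat.of D Y.E₁)
    (hι : ModuleCat.ofHom X.ι₁ ≫ a = ModuleCat.ofHom Y.ι₁)
    (hπ : a ≫ ModuleCat.ofHom Y.π₁ = ModuleCat.ofHom X.π₁)
    (ha : X.fullClass.comp (Ext.mk₀ a) (add_zero 1) = Y.fullClass) : X.Equivalent Y := by
  let ψ : X.G₁ ⟶ Y.G₁ :=
    { τ₁ := 𝟙 N
      τ₂ := a
      τ₃ := 𝟙 L
      comm₁₂ := (Category.id_comp _).trans hι.symm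
      comm₂₃ := hπ.trans (Category.comp_id _).symm }
  have hψ₁ : IsIso ψ.τ₁ := inferInstanceAs (IsIso (𝟙 N))
  have hψ₃ : IsIso ψ.τ₃ := inferInstanceAs (IsIso (𝟙 L))
  have hiso : IsIso a :=
    ShortComplex.isIso₂_of_shortExact_of_isIso₁₃ ψ X.G₁_shortExact Y.G₁_shortExact
  obtain ⟨φ, hφ₁, hφ₃⟩ := ShortComplex.ShortExact.exists_hom_of_extClass_comp_eq
    X.G_shortExact Y.G_shortExact a (𝟙 M) (ha.trans (Ext.mk₀_id_comp _).symm)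
  have hi₁ : IsIso φ.τ₁ := by rw [hφ₁]; exact hiso
  have hi₃ : IsIso φ.τ₃ := by rw [hφ₃]; exact inferInstanceAs (IsIso (𝟙 M))
  have hi₂ : IsIso φ.τ₂ :=
    ShortComplex.isIso₂_of_shortExact_of_isIso₁₃ φ X.G_shortExact Y.G_shortExact
  let α : X.E ≃ₗ[D] Y.E := (asIso φ.τ₂).toLinearEquiv
  have hα₁ : ∀ x : X.E₁, α x = (a.hom x : Y.E) := fun x => by
    have := congrArg (fun t => t.hom x) φ.comm₁₂
    rw [hφ₁] at this
    exact this.symm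
  have hα₃ : ∀ x : X.E, Y.top (Submodule.Quotient.mk (α x)) =
      X.top (Submodule.Quotient.mk x) := fun x => by
    have := congrArg (fun t => t.hom x) φ.comm₂₃
    rw [hφ₃] at this
    exact this
  have hι' : ∀ x : X.E₂, α x = (Y.bot.symm (X.bot x) : Y.E) := fun x => by
    have := congrArg (fun t => (t.hom (X.bot x)).1) hι
    have h2 := hα₁ (Submodule.inclusion X.le x)
    refine h2.trans (Eq.trans ?_ this)
    simp [ι₁]
  refine ⟨α, ?_, ?_, hα₃, ?_, ?_⟩
  · ext y
    rw [Submodule.mem_map]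
    obtain ⟨x, rfl⟩ := α.surjective y
    have := hα₃ x
    have hiff : α x ∈ Y.E₁ ↔ x ∈ X.E₁ := by
      rw [← Submodule.Quotient.mk_eq_zero, ← Submodule.Quotient.mk_eq_zero,
        ← Y.top.map_eq_zero_iff, this, X.top.map_eq_zero_iff]
    rw [hiff]
    exact ⟨fun ⟨z, hz, hzx⟩ => α.injective hzx ▸ hz, fun hx => ⟨x, hx, rfl⟩⟩
  · ext y
    rw [Submodule.mem_map]
    constructor
    · rintro ⟨x, hx, rfl⟩
      exact (hι' ⟨x, hx⟩).symm ▸ (Y.bot.symm _).2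
    · intro hy
      refine ⟨X.bot.symm (Y.bot ⟨y, hy⟩), Subtype.property _, ?_⟩
      refine (hι' _).trans ?_
      simp
  · intro x y hxy
    have hy : y = a.hom x := Subtype.ext (hxy.trans (hα₁ x))
    rw [hy]
    exact congrArg (fun t => t.hom x) hπ
  · intro x y hxy
    rw [← Y.bot.eq_symm_apply]
    exact Subtype.ext (hxy.trans (hι' x))

end ExtClass

/-! ### Building extension modules from two extensions. -/

section OfExtension

variable {A E : ModuleCat.{v} D} (i : N ⟶ A) (p : A ⟶ L) (f : A ⟶ E) (g : E ⟶ M)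
  (zero : i ≫ p = 0) (zero' : f ≫ g = 0)
  (hip : (ShortComplex.mk i p zero).ShortExact) (hfg : (ShortComplex.mk f g zero').ShortExact)

/-- The identification of `A` with the image of an extension `0 → A → E → M → 0`. -/
noncomputable def equivRange : A ≃ₗ[D] LinearMap.range f.hom :=
  LinearEquiv.ofInjective f.hom hfg.moduleCat_injective_f

/-- The 2-extension module `E ≥ A ≥ N` assembled from an extension `A` of `L` by `N` and an
extension `E` of `M` by `A`. -/
noncomputable def ofExtension : TwoExtensionModuleOf M L N where
  E := E
  E₁ := LinearMap.range f.hom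
  E₂ := LinearMap.range (f.hom ∘ₗ i.hom)
  le := LinearMap.range_comp_le_range _ _
  top := (Submodule.quotEquivOfEq _ _
      ((ShortComplex.moduleCat_exact_iff_range_eq_ker _).1 hfg.exact)).trans
    (g.hom.quotKerEquivOfSurjective hfg.moduleCat_surjective_g)
  mid := (Submodule.quotEquivOfEq _ _ (by
      ext y
      obtain ⟨x, rfl⟩ := (equivRange f g zero' hfg).surjective y
      have hx := (ShortComplex.ShortExact.moduleCat_exact_iff_function_exact _).1 hip.exact x
      have hinj := hfg.moduleCat_injective_f
      rw [LinearMap.mem_ker, LinearMap.comp_apply, LinearEquiv.coe_coe,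
        LinearEquiv.symm_apply_apply]
      refine Iff.trans ?_ hx.symm
      exact ⟨fun ⟨n, hn⟩ => ⟨n, hinj hn⟩, fun ⟨n, hn⟩ => ⟨n, congrArg f.hom hn⟩⟩)).trans
    ((p.hom ∘ₗ (equivRange f g zero' hfg).symm.toLinearMap).quotKerEquivOfSurjective
      (hip.moduleCat_surjective_g.comp (equivRange f g zero' hfg).symm.surjective))
  bot := (LinearEquiv.ofInjective (f.hom ∘ₗ i.hom)
    (hfg.moduleCat_injective_f.comp hip.moduleCat_injective_f)).symm

/-- The canonical morphism from `A` to the first step of the chain of `ofExtension`. -/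
noncomputable def toE₁ : A ⟶ ModuleCat.of D (ofExtension i p f g zero zero' hip hfg).E₁ :=
  ModuleCat.ofHom (equivRange f g zero' hfg).toLinearMap

theorem comp_toE₁ : i ≫ toE₁ i p f g zero zero' hip hfg =
    ModuleCat.ofHom (ofExtension i p f g zero zero' hip hfg).ι₁ := by
  ext n
  rfl

theorem toE₁_comp : toE₁ i p f g zero zero' hip hfg ≫
    ModuleCat.ofHom (ofExtension i p f g zero zero' hip hfg).π₁ = p := by
  ext x
  change p.hom ((equivRange f g zero' hfg).symm (equivRange f g zero' hfg x)) = p.hom x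
  rw [LinearEquiv.symm_apply_apply]

variable [Small.{v} D]

/-- `E₁` is the image of `A` in `E`, not `A` itself; this transports the class along that
identification. -/
theorem extClass_comp_toE₁ :
    hfg.extClass.comp (Ext.mk₀ (toE₁ i p f g zero zero' hip hfg)) (add_zero 1) =
      (ofExtension i p f g zero zero' hip hfg).fullClass := by
  let φ : ShortComplex.mk f g zero' ⟶ (ofExtension i p f g zero zero' hip hfg).G :=
    { τ₁ := toE₁ i p f g zero zero' hip hfg
      τ₂ := 𝟙 E
      τ₃ := 𝟙 M
      comm₁₂ := by ext x; rfl
      comm₂₃ := by ext x; rfl }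
  exact (ShortComplex.ShortExact.extClass_naturality hfg (G_shortExact _) φ).trans
    (Ext.mk₀_id_comp _)

theorem class₀_ofExtension : (ofExtension i p f g zero zero' hip hfg).class₀ =
    hfg.extClass.comp (Ext.mk₀ p) (add_zero 1) := by
  rw [← fullClass_comp_π₁, ← extClass_comp_toE₁,
    Ext.comp_assoc _ _ _ (add_zero 1) (zero_add 0) (by lia), Ext.mk₀_comp_mk₀, toE₁_comp]

theorem class₁_ofExtension : (ofExtension i p f g zero zero' hip hfg).class₁ = hip.extClass := by
  let φ : ShortComplex.mk i p zero ⟶ (ofExtension i p f g zero zero' hip hfg).G₁ :=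
    { τ₁ := 𝟙 N
      τ₂ := toE₁ i p f g zero zero' hip hfg
      τ₃ := 𝟙 L
      comm₁₂ := (Category.id_comp _).trans (comp_toE₁ i p f g zero zero' hip hfg).symm
      comm₂₃ := (toE₁_comp i p f g zero zero' hip hfg).trans (Category.comp_id _).symm }
  exact ((Ext.comp_mk₀_id _).symm.trans
    (ShortComplex.ShortExact.extClass_naturality hip (G₁_shortExact _) φ)).trans
      (Ext.mk₀_id_comp _) |>.symm

end OfExtension

end TwoExtensionModuleOf

/-! ### The action of `Ext¹(M, N)` and its indeterminacy. -/

namespace TwoExtensionModuleOf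

variable {D : Type u} [Ring D] {M L N : ModuleCat.{v} D}

/-- A morphism `d : E₁ → E₁'` which vanishes on `N` and has image in `N` factors through a
morphism `L → N`. -/
theorem exists_factorization {X Y : TwoExtensionModuleOf M L N}
    (d : ModuleCat.of D X.E₁ ⟶ ModuleCat.of D Y.E₁)
    (hι : ModuleCat.ofHom X.ι₁ ≫ d = 0) (hπ : d ≫ ModuleCat.ofHom Y.π₁ = 0) :
    ∃ h : L ⟶ N, d = ModuleCat.ofHom X.π₁ ≫ h ≫ ModuleCat.ofHom Y.ι₁ := by
  have := X.G₁_shortExact.epi_g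
  have := Y.G₁_shortExact.mono_f
  let l : L ⟶ ModuleCat.of D Y.E₁ := X.G₁_shortExact.exact.desc d hι
  have hl : ModuleCat.ofHom X.π₁ ≫ l = d := X.G₁_shortExact.exact.g_desc d hι
  have hlπ : l ≫ ModuleCat.ofHom Y.π₁ = 0 := by
    have hepi : Epi (ModuleCat.ofHom X.π₁) := X.G₁_shortExact.epi_g
    rw [← cancel_epi (ModuleCat.ofHom X.π₁), ← Category.assoc, hl, hπ, Limits.comp_zero]
  refine ⟨Y.G₁_shortExact.exact.lift l hlπ, ?_⟩
  rw [← hl]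
  exact congrArg _ (Y.G₁_shortExact.exact.lift_f l hlπ).symm

variable [Small.{v} D]

/-- Every class of `Ext¹(M, N)` can be added to a 2-extension module without changing the classes
of the two short exact sequences `G₀` and `G₁`. -/
theorem exists_fullClass_eq_add (X : TwoExtensionModuleOf M L N) (x : Ext M N 1) :
    ∃ (Y : TwoExtensionModuleOf M L N) (b : ModuleCat.of D X.E₁ ⟶ ModuleCat.of D Y.E₁),
      Y.class₀ = X.class₀ ∧ Y.class₁ = X.class₁ ∧
      ModuleCat.ofHom X.ι₁ ≫ b = ModuleCat.ofHom Y.ι₁ ∧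
      b ≫ ModuleCat.ofHom Y.π₁ = ModuleCat.ofHom X.π₁ ∧
      Y.fullClass = X.fullClass.comp (Ext.mk₀ b) (add_zero 1) +
        x.comp (Ext.mk₀ (ModuleCat.ofHom Y.ι₁)) (add_zero 1) := by
  -- `E₁` is kept and only its extension by `M` changes. The added term comes from `N`, so it dies
  -- in `Ext¹(M, L)`.
  obtain ⟨E, f, g, zero', hfg, he⟩ := ShortComplex.ShortExact.exists_extClass_eq
    (X.fullClass + x.comp (Ext.mk₀ (ModuleCat.ofHom X.ι₁)) (add_zero 1))
  have hz : ModuleCat.ofHom X.ι₁ ≫ ModuleCat.ofHom X.π₁ = 0 := X.G₁.zero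
  have hip : (ShortComplex.mk _ _ hz).ShortExact := X.G₁_shortExact
  refine ⟨ofExtension _ _ f g hz zero' hip hfg, toE₁ _ _ f g hz zero' hip hfg, ?_,
    class₁_ofExtension _ _ _ _ _ _ _ _, comp_toE₁ _ _ _ _ _ _ _ _, toE₁_comp _ _ _ _ _ _ _ _, ?_⟩
  · rw [class₀_ofExtension, he, Ext.add_comp, fullClass_comp_π₁,
      Ext.comp_assoc _ _ _ (add_zero 1) (zero_add 0) (by lia), Ext.mk₀_comp_mk₀, hz,
      Ext.mk₀_zero, Ext.comp_zero, add_zero]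
  · rw [← extClass_comp_toE₁, he, Ext.add_comp, ← comp_toE₁, ← Ext.mk₀_comp_mk₀,
      ← Ext.comp_assoc _ _ _ (add_zero 1) (zero_add 0) (by lia)]

/-- The effect on `fullClass` of changing the comparison map by `h : L ⟶ N`; this is the source of
the summand `ηML ∘ Hom(L, N)`. -/
theorem fullClass_comp_factorization {X Y : TwoExtensionModuleOf M L N} (h : L ⟶ N) :
    X.fullClass.comp (Ext.mk₀ (ModuleCat.ofHom X.π₁ ≫ h ≫ ModuleCat.ofHom Y.ι₁)) (add_zero 1) =
      (X.class₀.comp (Ext.mk₀ h) (add_zero 1)).comp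
        (Ext.mk₀ (ModuleCat.ofHom Y.ι₁)) (add_zero 1) := by
  rw [← fullClass_comp_π₁, ← Ext.mk₀_comp_mk₀, ← Ext.mk₀_comp_mk₀,
    Ext.comp_assoc _ _ _ (add_zero 1) (zero_add 0) (by lia),
    Ext.comp_assoc _ _ _ (add_zero 1) (zero_add 0) (by lia)]

theorem class₁_comp_ι₁ (Y : TwoExtensionModuleOf M L N) :
    Y.class₁.comp (Ext.mk₀ (ModuleCat.ofHom Y.ι₁)) (add_zero 1) = 0 :=
  Y.G₁_shortExact.extClass_comp

/-- If all 2-extension modules with the classes of `X` are equivalent to `X`, then the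
indeterminacy of the classes of `X` is all of `Ext¹(M, N)`. -/
theorem cocycleIndeterminacy_eq_top (X : TwoExtensionModuleOf M L N)
    (hX : ∀ Y : TwoExtensionModuleOf M L N, Y.class₀ = X.class₀ → Y.class₁ = X.class₁ →
      X.Equivalent Y) : cocycleIndeterminacy X.class₀ X.class₁ = ⊤ := by
  refine (AddSubgroup.eq_top_iff' _).2 fun x => ?_
  obtain ⟨Y, b, h₀, h₁, hbι, hbπ, hb⟩ := X.exists_fullClass_eq_add x
  obtain ⟨a, haι, haπ, ha⟩ := (hX Y h₀ h₁).exists_hom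
  obtain ⟨h, hh⟩ := exists_factorization (a - b) (by rw [Preadditive.comp_sub, haι, hbι, sub_self])
    (by rw [Preadditive.sub_comp, haπ, hbπ, sub_self])
  have hx : (x - X.class₀.comp (Ext.mk₀ h) (add_zero 1)).comp
      (Ext.mk₀ (ModuleCat.ofHom Y.ι₁)) (add_zero 1) = 0 := by
    rw [← sub_add_cancel a b, hh, Ext.mk₀_add, Ext.comp_add, fullClass_comp_factorization, hb,
      add_comm, add_right_inj] at ha
    rw [sub_eq_add_neg, Ext.add_comp, Ext.neg_comp, ha, add_neg_cancel]
  -- The kernel of pushing forward along `ι₁` consists of the connecting images `t ∘ ηLN`.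
  obtain ⟨t, ht⟩ := Ext.covariant_sequence_exact₁ M Y.G₁_shortExact _ hx (zero_add 1)
  have hsum : x = t.comp X.class₁ (zero_add 1) + X.class₀.comp (Ext.mk₀ h) (add_zero 1) := by
    rw [← h₁]
    exact (sub_eq_iff_eq_add.1 ht.symm)
  rw [hsum]
  exact add_mem (AddSubgroup.mem_sup_left ⟨t, rfl⟩) (AddSubgroup.mem_sup_right ⟨Ext.mk₀ h, rfl⟩)

/-- If the indeterminacy is all of `Ext¹(M, N)`, then two 2-extension modules with the same
classes are equivalent. -/
theorem Equivalent.of_cocycleIndeterminacy_eq_top {X Y : TwoExtensionModuleOf M L N}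
    (h₀ : X.class₀ = Y.class₀) (h₁ : X.class₁ = Y.class₁)
    (htop : cocycleIndeterminacy X.class₀ X.class₁ = ⊤) : X.Equivalent Y := by
  obtain ⟨φ, hφ₁, hφ₃⟩ := ShortComplex.ShortExact.exists_hom_of_extClass_comp_eq
    X.G₁_shortExact Y.G₁_shortExact (𝟙 N) (𝟙 L)
    ((Ext.comp_mk₀_id _).trans (h₁.trans (Ext.mk₀_id_comp _).symm))
  let a : ModuleCat.of D X.E₁ ⟶ ModuleCat.of D Y.E₁ := φ.τ₂
  have haι : ModuleCat.ofHom X.ι₁ ≫ a = ModuleCat.ofHom Y.ι₁ := by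
    have := φ.comm₁₂
    rw [hφ₁] at this
    exact this.symm.trans (Category.id_comp _)
  have haπ : a ≫ ModuleCat.ofHom Y.π₁ = ModuleCat.ofHom X.π₁ := by
    have := φ.comm₂₃
    rw [hφ₃] at this
    exact this.trans (Category.comp_id _)
  have hX : ModuleCat.ofHom X.ι₁ ≫ ModuleCat.ofHom X.π₁ = 0 := X.G₁.zero
  have hY : ModuleCat.ofHom Y.ι₁ ≫ ModuleCat.ofHom Y.π₁ = 0 := Y.G₁.zero
  -- The map `a` need not match the full classes, but both lie over the same `class₀`, so their
  -- difference comes from `Ext¹(M, N)`.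
  have hdiff : (X.fullClass.comp (Ext.mk₀ a) (add_zero 1) - Y.fullClass).comp
      (Ext.mk₀ (ModuleCat.ofHom Y.π₁)) (add_zero 1) = 0 := by
    rw [sub_eq_add_neg, Ext.add_comp, Ext.neg_comp, fullClass_comp_π₁,
      Ext.comp_assoc _ _ _ (add_zero 1) (zero_add 0) (by lia), Ext.mk₀_comp_mk₀, haπ,
      fullClass_comp_π₁, h₀, add_neg_cancel]
  obtain ⟨x, hx⟩ := Ext.covariant_sequence_exact₂ M Y.G₁_shortExact _ hdiff
  change Ext M N 1 at x
  replace hx : x.comp (Ext.mk₀ (ModuleCat.ofHom Y.ι₁)) (add_zero 1) =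
      X.fullClass.comp (Ext.mk₀ a) (add_zero 1) - Y.fullClass := hx
  obtain ⟨_, ⟨t, rfl⟩, _, ⟨s, rfl⟩, hsum⟩ :=
    AddSubgroup.mem_sup.1 ((AddSubgroup.eq_top_iff' _).1 htop x)
  obtain ⟨h, rfl⟩ := (Ext.mk₀_bijective _ _).2 s
  replace hsum : t.comp X.class₁ (zero_add 1) + X.class₀.comp (Ext.mk₀ h) (add_zero 1) = x := hsum
  -- The `t` part is killed by `ι₁`; the `h` part is cancelled by subtracting the map through `h`
  -- from `a`.
  rw [← hsum, h₁, Ext.add_comp, Ext.comp_assoc _ _ _ (zero_add 1) (add_zero 1) (by lia),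
    class₁_comp_ι₁, Ext.comp_zero, zero_add, ← fullClass_comp_factorization] at hx
  refine Equivalent.of_hom (a - ModuleCat.ofHom X.π₁ ≫ h ≫ ModuleCat.ofHom Y.ι₁) ?_ ?_ ?_
  · rw [Preadditive.comp_sub, haι, ← Category.assoc, hX, Limits.zero_comp, sub_zero]
  · rw [Preadditive.sub_comp, haπ, Category.assoc, Category.assoc, hY, Limits.comp_zero,
      Limits.comp_zero, sub_zero]
  · rw [sub_eq_add_neg, Ext.mk₀_add, Ext.mk₀_neg, Ext.comp_add, Ext.comp_neg, hx, neg_sub,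
      add_sub_cancel]

end TwoExtensionModuleOf

theorem mainTheorem3 {D : Type u} [Ring D] [Small.{v} D] {M L N : ModuleCat.{v} D}
    (ηML : Ext M L 1) (ηLN : Ext L N 1) :
    IsRigidPair ηML ηLN ↔
      Nonempty (AdmissibleExtModule ηML ηLN) ∧ Subsingleton (ExtOneCocycles ηML ηLN) := by
  rw [IsRigidPair, Nat.card_eq_one_iff_unique,
    show Subsingleton (ExtOneCocycles ηML ηLN) ↔ cocycleIndeterminacy ηML ηLN = ⊤ from
      ⟨QuotientAddGroup.addSubgroup_eq_top_of_subsingleton _,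
        fun h => by
          rw [ExtOneCocycles, h]
          exact QuotientAddGroup.subsingleton_quotient_top⟩]
  constructor
  · rintro ⟨hsub, ⟨q⟩⟩
    obtain ⟨⟨X, rfl, rfl⟩, -⟩ := Quotient.exists_rep q
    refine ⟨⟨⟨X, rfl, rfl⟩⟩, X.cocycleIndeterminacy_eq_top fun Y h₀ h₁ => ?_⟩
    exact Quotient.exact (hsub.elim (Quotient.mk (extModSetoid _ _) ⟨X, rfl, rfl⟩)
      (Quotient.mk (extModSetoid _ _) ⟨Y, h₀, h₁⟩))
  · rintro ⟨⟨X⟩, htop⟩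
    refine ⟨⟨?_⟩, ⟨Quotient.mk _ X⟩⟩
    rintro ⟨⟨Y, rfl, rfl⟩⟩ ⟨⟨Z, h₀, h₁⟩⟩
    exact Quotient.sound
      (TwoExtensionModuleOf.Equivalent.of_cocycleIndeterminacy_eq_top h₀.symm h₁.symm htop)
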